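/- Let $n\ge 0$ be an integer, $N=\{1,\dots,n\}$, $\hat N=\{1,\dots,n+1\}$. Let $c=(c_k)_{k\in N}$ be non-negative rational numbers (for instance non-negative integers), and let $\prec$ be a strict linear order on $N$ with $c_i\le c_j$ whenever $i\prec j$. Let $r^1,\dots,r^{n+1}$ be the coordinate functions on $\mathbb Q^{n+1}$. **Complete tableaux.** A complete tableau $\mathscr T$ has columns $C_1,\dots,C_{n+1}$ of heights $ht(C_i)\in\mathbb N$ such that: for $m$ odd (resp. even), if some column has height $\ge m$, then $C_{n+1}$ (resp. $C_1$) has height $\ge m$; if $ht(C_{k+1})=m$ is odd, then $ht(C_k)\ge m-2$ and $ht(C_{k+2})\ge m-1$; if $ht(C_{k+1})=m$ is even, then $ht(C_k)\ge m-1$ and $ht(C_{k+2})\ge m-2$ (whenever these columns exist). Two distinct columns of height $\ge m$ are neighbouring at level $m$ if all columns strictly between them have height $<m$. **The function of a tableau.** $f_{\mathscr T}$ is the sum of the following linear functions over all rows $m\ge 1$. For $m$ odd, every pair $C_k,C_j$ with $k<j$ neighbouring at level $m$ contributes $c_k(r^k-r^j)$. For $m$ even, every pair $C_j,C_{k+1}$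 with $j<k+1$ neighbouring at level $m$ contributes $c_k(r^{k+1}-r^j)$. **The set $H(c)$.** Let $P(\mathscr T)$ be the reflexive and transitive relation on $N$ generated by the following pairs. For $m$ odd and $C_j,C_{k+1}$ with $j\le k$ neighbouring at level $m$: $(j,k)$, and $(j,i)$ for each column $C_{i+1}$ of height $m-1$ strictly between them. For $m\ge2$ even and $C_k,C_{j+1}$ with $k\le j$ neighbouring at level $m$: $(j,k)$, and $(j,i)$ for each column $C_i$ of height $m-1$ strictly between them. Then $H(c)$ is the set of complete tableaux $\mathscr T$ such that every $(a,b)\in P(\mathscr T)$ satisfies $a=b$ or $a\prec b$. **The set $K(c)$.** Let $s_1\prec s_2\prec\dots\prec s_n$ be the elements of $N$ and, for $k\in N$, write $N_k=\{s_1,\dots,s_k\}=\{t_1<t_2<\dots<t_k\}$ in the natural order. Then $K(c)$ is the set of all $(c_k')_{k\in N}\in\mathbb Q^n$ such that $$0\le c_k'\le c_k\quad\text{for all }k\in N,\tag{2}$$ $$c'_{t_{i+1}}-c'_{t_i}\ \ge\ \min\{0,\ c_{t_{i+1}}-c_{t_i}\}\quad\text{for } i=1,\dots,k-1,\tag{3$_k$}$$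 where (3$_k$) is imposed for every $k\in N$. **Proposition 3.2.** For every $\mathscr T\in H(c)$ there is a unique vector $(c_k^{\mathscr T})_{k\in N}\in\mathbb Q^n$ with $f_{\mathscr T}=\sum_{k\in N}c_k^{\mathscr T}(r^k-r^{k+1})$, and this vector lies in $K(c)$. -/

import Mathlib

open scoped BigOperators

namespace SGraph

/-- A complete tableau with `n + 1` columns `C_1, …, C_{n+1}`, given by its column heights:
`height p` is the height of the column `C_{p+1}` (the index `p : Fin (n + 1)` starts at `0`).
Every odd row that is not empty meets the last column and every even row that is not empty meets
the first one.  If `C_{k+1}` has odd height `m`, then `C_k` has height `≥ m - 2` and `C_{k+2}` has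
height `≥ m - 1`; if it has even height `m`, then `C_k` has height `≥ m - 1` and `C_{k+2}` has
height `≥ m - 2` (whenever these columns exist). -/
structure CompleteTableau (n : ℕ) where
  /-- the heights of the columns -/
  height : Fin (n + 1) → ℕ
  odd_row : ∀ (m : ℕ) (p : Fin (n + 1)), Odd m → m ≤ height p → m ≤ height (Fin.last n)
  even_row : ∀ (m : ℕ) (p : Fin (n + 1)), Even m → m ≤ height p → m ≤ height 0
  left_of_odd : ∀ k : Fin n, Odd (height k.succ) → height k.succ ≤ height k.castSucc + 2
  right_of_odd : ∀ k : Fin n, Odd (height k.castSucc) → height k.castSucc ≤ height k.succ + 1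
  left_of_even : ∀ k : Fin n, Even (height k.succ) → height k.succ ≤ height k.castSucc + 1
  right_of_even : ∀ k : Fin n, Even (height k.castSucc) → height k.castSucc ≤ height k.succ + 2

/-- The linear function `r^j` on the `n + 1` dimensional space; the `r^j` are linearly
independent. -/
def r (n : ℕ) (j : Fin (n + 1)) : (Fin (n + 1) → ℚ) →ₗ[ℚ] ℚ := LinearMap.proj j

/-- The linear function `∑ a_i (r^i - r^{i+1})` with coefficient vector `a`. -/
def ofCoeffs {n : ℕ} (a : Fin n → ℚ) : (Fin (n + 1) → ℚ) →ₗ[ℚ] ℚ :=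
  ∑ i : Fin n, a i • (r n i.castSucc - r n i.succ)

namespace CompleteTableau

variable {n : ℕ}

/-- The height of a tableau: the maximum of the heights of its columns. -/
def totalHeight (T : CompleteTableau n) : ℕ := Finset.univ.sup T.height

/-- The columns with indices `p < q` are neighbouring at level `m`: both have height `≥ m`, and
every column strictly between them has height `< m`. -/
def Neighbouring (T : CompleteTableau n) (m : ℕ) (p q : Fin (n + 1)) : Prop :=
  p < q ∧ m ≤ T.height p ∧ m ≤ T.height q ∧ ∀ i, p < i → i < q → T.height i < m

open Classical in
/-- The contribution of row `m` to the function of a tableau.  In an odd row the column `C_k`,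
`k ≤ n`, carries the entry `c_k` and contributes `c_k (r^k - r^j)`, where `C_j` is the nearest
column to its right of height `≥ m`.  In an even row the column `C_{k+1}`, `k ≥ 1`, carries the
entry `c_k` and contributes `c_k (r^{k+1} - r^j)`, where `C_j` is the nearest column to its left of
height `≥ m`. -/
noncomputable def rowFunction (T : CompleteTableau n) (c : Fin n → ℚ) (m : ℕ) :
    (Fin (n + 1) → ℚ) →ₗ[ℚ] ℚ :=
  if Odd m then
    ∑ k : Fin n, ∑ j : Fin (n + 1),
      if T.Neighbouring m k.castSucc j then c k • (r n k.castSucc - r n j) else 0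
  else
    ∑ k : Fin n, ∑ j : Fin (n + 1),
      if T.Neighbouring m j k.succ then c k • (r n k.succ - r n j) else 0

/-- The function `f_T` of a tableau (with driving function zero): the sum of the contributions of
its rows. -/
noncomputable def f (T : CompleteTableau n) (c : Fin n → ℚ) : (Fin (n + 1) → ℚ) →ₗ[ℚ] ℚ :=
  ∑ m ∈ Finset.Icc 1 T.totalHeight, T.rowFunction c m

/-- The relations that generate the order `P(T)` on `N`.

For `m` odd and columns `C_j`, `C_{k+1}` with `j ≤ k` neighbouring at level `m`: the relation
`j ≺ k`, and `j ≺ i` for every column `C_{i+1}` of height `m - 1` between them.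

For `m` even and columns `C_k`, `C_{j+1}` with `k ≤ j` neighbouring at level `m`: the relation
`j ≺ k`, and `j ≺ i` for every column `C_i` of height `m - 1` between them. -/
inductive Gen (T : CompleteTableau n) : Fin n → Fin n → Prop
  | odd (m : ℕ) (j k : Fin n) : Odd m → T.Neighbouring m j.castSucc k.succ → Gen T j k
  | odd_between (m : ℕ) (j k i : Fin n) : Odd m → T.Neighbouring m j.castSucc k.succ →
      j.castSucc < i.succ → i.succ < k.succ → T.height i.succ + 1 = m → Gen T j i
  | even (m : ℕ) (j k : Fin n) : Even m → 0 < m → T.Neighbouring m k.castSucc j.succ → Gen T j k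
  | even_between (m : ℕ) (j k i : Fin n) : Even m → 0 < m →
      T.Neighbouring m k.castSucc j.succ →
      k.castSucc < i.castSucc → i.castSucc < j.succ → T.height i.castSucc + 1 = m → Gen T j i

/-- The order `P(T)` on `N`, as a reflexive relation: the reflexive and transitive closure of its
generating relations. -/
def P (T : CompleteTableau n) : Fin n → Fin n → Prop := Relation.ReflTransGen T.Gen

end CompleteTableau

/-- The complete tableaux which represent the elements of `H(c)`: those whose order `P(T)` is
contained in the given strict linear order `prec` on `N`. -/
def H {n : ℕ} (prec : Fin n → Fin n → Prop) : Set (CompleteTableau n) :=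
  {T | ∀ a b, T.P a b → a = b ∨ prec a b}

/-- `N_k`: the set of the `k` smallest elements `s_1 ≺ … ≺ s_k` of `N` with respect to `prec`. -/
def initialSet {n : ℕ} (prec : Fin n → Fin n → Prop) (k : ℕ) : Set (Fin n) :=
  {i | {j | prec j i}.ncard < k}

/-- `t < t'` are consecutive elements of `S` in the natural order. -/
def Consecutive {n : ℕ} (S : Set (Fin n)) (t t' : Fin n) : Prop :=
  t ∈ S ∧ t' ∈ S ∧ t < t' ∧ ∀ i ∈ S, ¬ (t < i ∧ i < t')

/-- The set `K(c)`: all `a` with `0 ≤ a_k ≤ c_k` for all `k`, and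
`a_{t'} - a_t ≥ min {0, c_{t'} - c_t}` for all `k` in `{1, …, n}` and all `t < t'` consecutive
in `N_k`. -/
def K {n : ℕ} (c : Fin n → ℚ) (prec : Fin n → Fin n → Prop) : Set (Fin n → ℚ) :=
  {a | (∀ k, 0 ≤ a k ∧ a k ≤ c k) ∧
    ∀ k ∈ Finset.Icc 1 n, ∀ t t', Consecutive (initialSet prec k) t t' →
      min 0 (c t' - c t) ≤ a t' - a t}

end SGraph

/-! Evaluating a function at `initialIndicator i` reads off its coefficient of `r^i - r^{i+1}`; this
gives uniqueness. In a given row at most one neighbouring pair straddles the gap between `C_i` and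
`C_{i+1}`, so the coefficient is an alternating sum `y 1 - y 2 + y 3 - ...`, where `y m` is the
entry of that pair, or 0 (`rowFunction_odd`, `rowFunction_even`).

The generators of `P(T)` link the entry over a gap in row `m + 1` to the one in row `m`
(`Covers.exists_gen`). Hence `y` decreases from `y 0 = c_i`, which gives the bounds (2), and every
index covering gap `i` lies below `i` in `P(T)`.

For (3), initial sets are closed downwards under `P(T)`, so no index strictly between consecutive `t
< t'` covers either gap. From some row on both gaps therefore have the same entries; before it, `t'`
covers its own gap in odd rows and `t` its own in even rows. `alternating_sum_compare` turns this
into the inequality. -/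

namespace SGraph

/-! ### Coordinates in the differences of consecutive coordinate functions -/

/-- The function which is `1` on the columns up to `i` and `0` on the later ones. -/
def initialIndicator {n : ℕ} (i : Fin n) : Fin (n + 1) → ℚ :=
  fun p => if p ≤ i.castSucc then 1 else 0

theorem ofCoeffs_apply {n : ℕ} (a : Fin n → ℚ) (v : Fin (n + 1) → ℚ) :
    ofCoeffs a v = ∑ i : Fin n, a i * (v i.castSucc - v i.succ) := by
  simp [ofCoeffs, r]

theorem initialIndicator_sub {n : ℕ} (i j : Fin n) :
    initialIndicator i j.castSucc - initialIndicator i j.succ = if i = j then 1 else 0 := by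
  unfold initialIndicator
  simp only [Fin.le_def, Fin.val_castSucc, Fin.val_succ, Fin.ext_iff]
  split_ifs <;> first | omega | norm_num

theorem ofCoeffs_initialIndicator {n : ℕ} (a : Fin n → ℚ) (i : Fin n) :
    ofCoeffs a (initialIndicator i) = a i := by
  simp [ofCoeffs_apply, initialIndicator_sub]

/-- Abel summation: the value at `p` is the last value plus all the jumps from `p` on. -/
theorem eq_sum_initialIndicator {n : ℕ} (v : Fin (n + 1) → ℚ) :
    v = v (Fin.last n) • (fun _ => 1) +
      ∑ i : Fin n, (v i.castSucc - v i.succ) • initialIndicator i := by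
  funext p
  simp only [Pi.add_apply, Pi.smul_apply, Finset.sum_apply, smul_eq_mul, mul_one]
  induction p using Fin.reverseInduction with
  | last =>
    have : ∀ i : Fin n, initialIndicator i (Fin.last n) = 0 := fun i => by
      have := i.isLt
      simp [initialIndicator, Fin.le_def]
    simp [this]
  | cast p ih =>
    have h : ∀ i : Fin n, initialIndicator i p.castSucc =
        initialIndicator i p.succ + if i = p then 1 else 0 := fun i => by
      rw [← initialIndicator_sub]; ring
    simp only [h, mul_add, Finset.sum_add_distrib]
    rw [← add_assoc, ← ih]
    simp

/-- A linear function that vanishes on constants is a combination of the `r^i - r^{i+1}`. -/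
theorem eq_ofCoeffs {n : ℕ} (φ : (Fin (n + 1) → ℚ) →ₗ[ℚ] ℚ) (h : φ (fun _ => 1) = 0) :
    φ = ofCoeffs (fun i => φ (initialIndicator i)) := by
  refine LinearMap.ext fun v => ?_
  rw [ofCoeffs_apply]
  conv_lhs => rw [eq_sum_initialIndicator v]
  simp only [map_add, map_smul, map_sum, h, smul_eq_mul, mul_zero, zero_add]
  exact Finset.sum_congr rfl fun i _ => mul_comm _ _

/-! ### Alternating sums of decreasing sequences -/

theorem alternating_sum_bounds {y s : ℕ → ℚ} (hs : s 0 = 0)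
    (hodd : ∀ m, Odd (m + 1) → s (m + 1) = s m + y (m + 1))
    (heven : ∀ m, Even (m + 1) → s (m + 1) = s m - y (m + 1))
    (hy : ∀ m, 0 ≤ y m) (hanti : ∀ m, y (m + 1) ≤ y m) (M : ℕ) :
    0 ≤ s M ∧ s M ≤ y 0 := by
  -- The bare bounds are not inductive: the slack `y M` pays for the next term, which is no larger.
  suffices (Odd M → y M ≤ s M ∧ s M ≤ y 0) ∧ (Even M → 0 ≤ s M ∧ s M ≤ y 0 - y M) by
    rcases Nat.even_or_odd M with h | h
    · exact ⟨(this.2 h).1, by linarith [(this.2 h).2, hy M]⟩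
    · exact ⟨by linarith [(this.1 h).1, hy M], (this.1 h).2⟩
  induction M with
  | zero => simp [hs]
  | succ M ih =>
    have := hanti M
    constructor <;> intro h
    · have := ih.2 (by simpa [Nat.odd_add_one] using h)
      rw [hodd M h]
      constructor <;> linarith
    · have := ih.1 (by simpa [Nat.even_add_one] using h)
      rw [heven M h]
      constructor <;> linarith

/-- Two alternating sums whose terms agree from some index on, while before it the second one
(at odd indices) and the first one (at even indices) have the maximal term. -/
theorem alternating_sum_compare {y y' s s' : ℕ → ℚ} (hs : s 0 = 0) (hs' : s' 0 = 0)
    (hodd : ∀ m, Odd (m + 1) → s (m + 1) = s m + y (m + 1))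
    (heven : ∀ m, Even (m + 1) → s (m + 1) = s m - y (m + 1))
    (hodd' : ∀ m, Odd (m + 1) → s' (m + 1) = s' m + y' (m + 1))
    (heven' : ∀ m, Even (m + 1) → s' (m + 1) = s' m - y' (m + 1))
    (hanti : Antitone y) (hanti' : Antitone y')
    (Q : ℕ → Prop) (hQ : ∀ m, Q (m + 1) → Q m)
    (hQo : ∀ m, Q m → Odd m → y' m = y' 0) (hQe : ∀ m, Q m → Even m → y m = y 0)
    (hnQ : ∀ m, ¬ Q m → y m = y' m) (M : ℕ) :
    min 0 (y' 0 - y 0) ≤ s' M - s M := by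
  -- While `Q` holds the difference is known exactly, because a maximal term forces all earlier
  -- terms of its sequence to be maximal. Once `Q` fails the added terms agree and the difference is
  -- frozen.
  suffices (Q M → Odd M → s' M - s M = y' 0 - y M) ∧
      (Q M → Even M → s' M - s M = y' 0 - y' M) ∧ min 0 (y' 0 - y 0) ≤ s' M - s M from this.2.2
  induction M with
  | zero => simp [hs, hs']
  | succ M ih =>
    obtain ⟨io, ie, ib⟩ := ih
    have ho : Q (M + 1) → Odd (M + 1) → s' (M + 1) - s (M + 1) = y' 0 - y (M + 1) := by
      intro q h
      have e := ie (hQ M q) (by simpa [Nat.odd_add_one] using h)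
      have e1 := hQo _ q h
      have e2 := hanti' (Nat.zero_le M)
      have e3 := hanti' (Nat.le_succ M)
      rw [Nat.succ_eq_add_one] at e3
      rw [hodd M h, hodd' M h]
      linarith
    have he : Q (M + 1) → Even (M + 1) → s' (M + 1) - s (M + 1) = y' 0 - y' (M + 1) := by
      intro q h
      have e := io (hQ M q) (by simpa [Nat.even_add_one] using h)
      have e1 := hQe _ q h
      have e2 := hanti (Nat.zero_le M)
      have e3 := hanti (Nat.le_succ M)
      rw [Nat.succ_eq_add_one] at e3
      rw [heven M h, heven' M h]
      linarith
    refine ⟨ho, he, ?_⟩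
    have e2 := hanti (Nat.zero_le (M + 1))
    have e3 := hanti' (Nat.zero_le (M + 1))
    rcases Nat.even_or_odd (M + 1) with h | h <;> by_cases q : Q (M + 1)
    · exact (min_le_left _ _).trans (by rw [he q h]; linarith)
    · rw [heven M h, heven' M h, hnQ _ q]; linarith
    · exact (min_le_right _ _).trans (by rw [ho q h]; linarith)
    · rw [hodd M h, hodd' M h, hnQ _ q]; linarith

theorem mem_initialSet_of_prec {n : ℕ} {prec : Fin n → Fin n → Prop}
    (hprec : IsStrictTotalOrder (Fin n) prec) {k : ℕ} {x t : Fin n}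
    (h : x = t ∨ prec x t) (ht : t ∈ initialSet prec k) : x ∈ initialSet prec k := by
  rcases h with rfl | h
  · exact ht
  · exact (Set.ncard_le_ncard (fun j hj => hprec.trans j x t hj h)
      (Set.toFinite _)).trans_lt ht

/-! ### The entry lying over a gap, row by row -/

namespace CompleteTableau

variable {n : ℕ}

/-- The entry `c_x` lies over the gap between the columns `C_i` and `C_{i+1}` in row `m`: for `m`
odd, `C_x` is the last column of height `≥ m` up to `C_i`; for `m` even, `C_{x+1}` is the first
column of height `≥ m` from `C_{i+1}` on. -/
def Covers (T : CompleteTableau n) (m : ℕ) (x i : Fin n) : Prop :=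
  (Odd m ∧ x ≤ i ∧ m ≤ T.height x.castSucc ∧ ∀ p, x < p → p ≤ i → T.height p.castSucc < m) ∨
  (Even m ∧ i ≤ x ∧ m ≤ T.height x.succ ∧ ∀ p, i ≤ p → p < x → T.height p.succ < m)

variable {T : CompleteTableau n} {m : ℕ} {x i : Fin n}

theorem covers_odd (hm : Odd m) : T.Covers m x i ↔
    x ≤ i ∧ m ≤ T.height x.castSucc ∧ ∀ p, x < p → p ≤ i → T.height p.castSucc < m := by
  simp [Covers, hm, Nat.not_even_iff_odd.2 hm]

theorem covers_even (hm : Even m) : T.Covers m x i ↔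
    i ≤ x ∧ m ≤ T.height x.succ ∧ ∀ p, i ≤ p → p < x → T.height p.succ < m := by
  simp [Covers, hm, Nat.not_odd_iff_even.2 hm]

theorem Covers.unique {x' : Fin n} (h : T.Covers m x i) (h' : T.Covers m x' i) : x = x' := by
  rcases Nat.even_or_odd m with hm | hm
  · rw [covers_even hm] at h h'
    rcases lt_trichotomy x x' with l | l | l
    · exact absurd (h'.2.2 x h.1 l) (not_lt.2 h.2.1)
    · exact l
    · exact absurd (h.2.2 x' h'.1 l) (not_lt.2 h'.2.1)
  · rw [covers_odd hm] at h h'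
    rcases lt_trichotomy x x' with l | l | l
    · exact absurd (h.2.2 x' l h'.1) (not_lt.2 h'.2.1)
    · exact l
    · exact absurd (h'.2.2 x l h.1) (not_lt.2 h.2.1)

theorem exists_covers_odd (hm : Odd m) {p : Fin n} (hp : p ≤ i) (h : m ≤ T.height p.castSucc) :
    ∃ x, T.Covers m x i ∧ p ≤ x := by
  obtain ⟨x, ⟨h1, h2, h3⟩, hx⟩ := wellFounded_gt.has_min
    {x : Fin n | p ≤ x ∧ x ≤ i ∧ m ≤ T.height x.castSucc} ⟨p, le_rfl, hp, h⟩
  refine ⟨x, (covers_odd hm).2 ⟨h2, h3, fun q hq hqi => ?_⟩, h1⟩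
  by_contra hc
  exact hx q ⟨h1.trans hq.le, hqi, not_lt.1 hc⟩ hq

theorem exists_covers_even (hm : Even m) {p : Fin n} (hp : i ≤ p) (h : m ≤ T.height p.succ) :
    ∃ x, T.Covers m x i ∧ x ≤ p := by
  obtain ⟨x, ⟨h1, h2, h3⟩, hx⟩ := wellFounded_lt.has_min
    {x : Fin n | x ≤ p ∧ i ≤ x ∧ m ≤ T.height x.succ} ⟨p, le_rfl, hp, h⟩
  refine ⟨x, (covers_even hm).2 ⟨h2, h3, fun q hq hqi => ?_⟩, h1⟩
  by_contra hc
  exact hx q ⟨hqi.le.trans h1, hq, not_lt.1 hc⟩ hqi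

theorem covers_zero : T.Covers 0 x i ↔ x = i := by
  refine ⟨fun h => ?_, ?_⟩
  · rw [covers_even Even.zero] at h
    by_contra hne
    exact absurd (h.2.2 i le_rfl (lt_of_le_of_ne h.1 (Ne.symm hne))) (Nat.not_lt_zero _)
  · rintro rfl
    exact (covers_even Even.zero).2 ⟨le_rfl, Nat.zero_le _, fun p h h' => absurd h (not_le.2 h')⟩

/-- In an odd row, a covering column has a right neighbour beyond the gap. -/
theorem Covers.exists_neighbouring_odd (hm : Odd m) (h : T.Covers m x i) :
    ∃ k : Fin n, i ≤ k ∧ T.Neighbouring m x.castSucc k.succ := by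
  rw [covers_odd hm] at h
  -- Completeness of odd rows supplies a column beyond the gap; the nearest such one is the
  -- neighbour.
  have hl : m ≤ T.height (Fin.last n) := T.odd_row m _ hm h.2.1
  obtain ⟨q, ⟨h1, h2⟩, hq⟩ := wellFounded_lt.has_min
    {q : Fin (n + 1) | i.castSucc < q ∧ m ≤ T.height q} ⟨Fin.last n, Fin.castSucc_lt_last i, hl⟩
  obtain ⟨k, rfl⟩ := Fin.exists_succ_eq.2 (Fin.ne_zero_of_lt h1)
  have hik : i ≤ k := Fin.castSucc_lt_succ_iff.1 h1
  refine ⟨k, hik, Fin.castSucc_lt_succ_iff.2 (h.1.trans hik), h.2.1, h2, fun p hp hpk => ?_⟩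
  by_contra hc
  rcases lt_or_ge i.castSucc p with l | l
  · exact hq p ⟨l, not_lt.1 hc⟩ hpk
  · have hp' : p ≠ Fin.last n := (l.trans_lt (Fin.castSucc_lt_last i)).ne
    obtain ⟨p, rfl⟩ := Fin.exists_castSucc_eq.2 hp'
    exact hc (h.2.2 p (by simpa using hp) (by simpa using l))

/-- In an even row, a covering column has a left neighbour beyond the gap. -/
theorem Covers.exists_neighbouring_even (hm : Even m) (h : T.Covers m x i) :
    ∃ k : Fin n, k ≤ i ∧ T.Neighbouring m k.castSucc x.succ := by
  rw [covers_even hm] at h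
  have hl : m ≤ T.height 0 := T.even_row m _ hm h.2.1
  obtain ⟨q, ⟨h1, h2⟩, hq⟩ := wellFounded_gt.has_min
    {q : Fin (n + 1) | q < i.succ ∧ m ≤ T.height q} ⟨0, Fin.succ_pos i, hl⟩
  obtain ⟨k, rfl⟩ := Fin.exists_castSucc_eq.2 (h1.trans_le (Fin.le_last _)).ne
  have hik : k ≤ i := Fin.castSucc_lt_succ_iff.1 h1
  refine ⟨k, hik, Fin.castSucc_lt_succ_iff.2 (hik.trans h.1), h2, h.2.1, fun p hp hpk => ?_⟩
  by_contra hc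
  rcases lt_or_ge p i.succ with l | l
  · exact hq p ⟨l, not_lt.1 hc⟩ hp
  · obtain ⟨p, rfl⟩ := Fin.exists_succ_eq.2 (Fin.ne_zero_of_lt hp)
    exact hc (h.2.2 p (by simpa using l) (by simpa using hpk))

theorem Neighbouring.right_unique {p q q' : Fin (n + 1)} (h : T.Neighbouring m p q)
    (h' : T.Neighbouring m p q') : q = q' := by
  rcases lt_trichotomy q q' with l | l | l
  · exact absurd (h'.2.2.2 q h.1 l) (not_lt.2 h.2.2.1)
  · exact l
  · exact absurd (h.2.2.2 q' h'.1 l) (not_lt.2 h'.2.2.1)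

theorem Neighbouring.left_unique {p q q' : Fin (n + 1)} (h : T.Neighbouring m q p)
    (h' : T.Neighbouring m q' p) : q = q' := by
  rcases lt_trichotomy q q' with l | l | l
  · exact absurd (h.2.2.2 q' l h'.1) (not_lt.2 h'.2.1)
  · exact l
  · exact absurd (h'.2.2.2 q l h.1) (not_lt.2 h.2.1)

theorem Neighbouring.covers_odd (hm : Odd m) {j : Fin (n + 1)}
    (h : T.Neighbouring m x.castSucc j) (hx : x ≤ i) (hj : i.castSucc < j) : T.Covers m x i :=
  (CompleteTableau.covers_odd hm).2 ⟨hx, h.2.1, fun p hp hpi =>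
    h.2.2.2 p.castSucc (by simpa using hp) (lt_of_le_of_lt (by simpa using hpi) hj)⟩

theorem Neighbouring.covers_even (hm : Even m) {j : Fin (n + 1)}
    (h : T.Neighbouring m j x.succ) (hx : i ≤ x) (hj : j ≤ i.castSucc) : T.Covers m x i :=
  (CompleteTableau.covers_even hm).2 ⟨hx, h.2.2.1, fun p hp hpi =>
    h.2.2.2 p.succ (hj.trans_lt (Fin.castSucc_lt_succ_iff.2 hp)) (by simpa using hpi)⟩

/-- The far neighbour in row `m + 1` also reaches row `m`, so some `x'` between it and the gap
covers the gap there. Either `x'` comes from that neighbour itself, or its column lies strictly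
between the pair and so has height exactly `m`: these are the two kinds of generators. -/
theorem Covers.exists_gen (h : T.Covers (m + 1) x i) : ∃ x', T.Covers m x' i ∧ T.Gen x x' := by
  rcases Nat.even_or_odd (m + 1) with hm | hm
  · have hm' : Odd m := by simpa [Nat.even_add_one] using hm
    obtain ⟨k, hki, hk⟩ := h.exists_neighbouring_even hm
    have hix := ((covers_even hm).1 h).1
    obtain ⟨x', hx', hkx⟩ := exists_covers_odd (T := T) hm' hki (by have := hk.2.1; omega)
    refine ⟨x', hx', ?_⟩
    have hx'' := (covers_odd hm').1 hx'
    rcases hkx.eq_or_lt with rfl | hlt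
    · exact Gen.even _ _ _ hm (Nat.succ_pos _) hk
    · have l1 : k.castSucc < x'.castSucc := by simpa using hlt
      have l2 : x'.castSucc < x.succ := Fin.castSucc_lt_succ_iff.2 (hx''.1.trans hix)
      have := hk.2.2.2 _ l1 l2
      exact Gen.even_between _ _ _ _ hm (Nat.succ_pos _) hk l1 l2 (by have := hx''.2.1; omega)
  · have hm' : Even m := by simpa [Nat.odd_add_one] using hm
    obtain ⟨k, hki, hk⟩ := h.exists_neighbouring_odd hm
    have hix := ((covers_odd hm).1 h).1
    obtain ⟨x', hx', hkx⟩ := exists_covers_even (T := T) hm' hki (by have := hk.2.2.1; omega)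
    refine ⟨x', hx', ?_⟩
    have hx'' := (covers_even hm').1 hx'
    rcases hkx.eq_or_lt with rfl | hlt
    · exact Gen.odd _ _ _ hm hk
    · have l1 : x'.succ < k.succ := by simpa using hlt
      have l2 : x.castSucc < x'.succ := Fin.castSucc_lt_succ_iff.2 (hix.trans hx''.1)
      have := hk.2.2.2 _ l2 l1
      exact Gen.odd_between _ _ _ _ hm hk l2 l1 (by have := hx''.2.1; omega)

theorem Covers.P (h : T.Covers m x i) : T.P x i := by
  induction m generalizing x with
  | zero => rw [covers_zero.1 h]; exact Relation.ReflTransGen.refl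
  | succ m ih =>
    obtain ⟨x', h', hg⟩ := h.exists_gen
    exact Relation.ReflTransGen.head hg (ih h')

/-! ### Coefficients as alternating sums of entries -/

open Classical in
/-- The entry of row `m` over the gap between the columns `C_i` and `C_{i+1}`. -/
noncomputable def entry (T : CompleteTableau n) (c : Fin n → ℚ) (m : ℕ) (i : Fin n) : ℚ :=
  ∑ x : Fin n, if T.Covers m x i then c x else 0

variable {c : Fin n → ℚ}

theorem Covers.entry_eq (h : T.Covers m x i) : T.entry c m i = c x := by
  unfold entry
  rw [Finset.sum_eq_single x]
  · rw [if_pos h]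
  · intro b _ hb
    exact if_neg fun h' => hb (h'.unique h)
  · simp

theorem entry_eq_zero (h : ∀ x, ¬ T.Covers m x i) : T.entry c m i = 0 := by
  simp [entry, h]

theorem entry_zero : T.entry c 0 i = c i := (covers_zero.2 rfl).entry_eq

theorem entry_nonneg (hc : ∀ k, 0 ≤ c k) (m : ℕ) (i : Fin n) : 0 ≤ T.entry c m i :=
  Finset.sum_nonneg fun x _ => by split_ifs <;> simp [hc]

theorem entry_succ_le (hc : ∀ k, 0 ≤ c k) (hmono : ∀ a b, T.P a b → c a ≤ c b) (m : ℕ)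
    (i : Fin n) : T.entry c (m + 1) i ≤ T.entry c m i := by
  by_cases h : ∃ x, T.Covers (m + 1) x i
  · obtain ⟨x, hx⟩ := h
    obtain ⟨x', hx', hg⟩ := hx.exists_gen
    rw [hx.entry_eq, hx'.entry_eq]
    exact hmono _ _ (Relation.ReflTransGen.single hg)
  · rw [entry_eq_zero (not_exists.1 h)]
    exact entry_nonneg hc _ _

theorem rowFunction_const (c : Fin n → ℚ) (m : ℕ) : T.rowFunction c m (fun _ => 1) = 0 := by
  unfold rowFunction
  split_ifs <;> simp only [LinearMap.sum_apply] <;>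
    refine Finset.sum_eq_zero fun k _ => Finset.sum_eq_zero fun j _ => ?_ <;>
    split_ifs <;> simp [r]

theorem rowFunction_odd (hm : Odd m) (c : Fin n → ℚ) (i : Fin n) :
    T.rowFunction c m (initialIndicator i) = T.entry c m i := by
  classical
  unfold rowFunction entry
  rw [if_pos hm]
  simp only [LinearMap.sum_apply]
  refine Finset.sum_congr rfl fun k _ => ?_
  -- The difference of coordinates is nonzero on the indicator only if the pair straddles the gap.
  have key : ∀ j, T.Neighbouring m k.castSucc j →
      (c k • (r n k.castSucc - r n j)) (initialIndicator i) =
        if k ≤ i ∧ i.castSucc < j then c k else 0 := fun j hj => by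
    have := hj.1
    simp only [r, initialIndicator, LinearMap.smul_apply, LinearMap.sub_apply,
      LinearMap.proj_apply, smul_eq_mul, ← not_lt (a := i.castSucc)]
    by_cases h1 : k ≤ i <;> by_cases h2 : i.castSucc < j
    · simp [h1, h2]
    · simp [h1, h2]
    · simp [h1, h2]
    · exact absurd (Fin.castSucc_le_castSucc_iff.1 (this.le.trans (not_lt.1 h2))) h1
  split_ifs with h
  · obtain ⟨q, hq, hN⟩ := h.exists_neighbouring_odd hm
    rw [Finset.sum_eq_single q.succ]
    · rw [if_pos hN, key _ hN, if_pos ⟨((covers_odd hm).1 h).1, Fin.castSucc_lt_succ_iff.2 hq⟩]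
    · intro b _ hb
      rw [if_neg fun h' => hb (h'.right_unique hN), LinearMap.zero_apply]
    · simp
  · refine Finset.sum_eq_zero fun j _ => ?_
    split_ifs with hN
    · rw [key _ hN, if_neg fun h' => h (hN.covers_odd hm h'.1 h'.2)]
    · rfl

theorem rowFunction_even (hm : Even m) (c : Fin n → ℚ) (i : Fin n) :
    T.rowFunction c m (initialIndicator i) = - T.entry c m i := by
  classical
  unfold rowFunction entry
  rw [if_neg (Nat.not_odd_iff_even.2 hm)]
  simp only [LinearMap.sum_apply, ← Finset.sum_neg_distrib]
  refine Finset.sum_congr rfl fun k _ => ?_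
  have key : ∀ j, T.Neighbouring m j k.succ →
      (c k • (r n k.succ - r n j)) (initialIndicator i) =
        if i ≤ k ∧ j ≤ i.castSucc then - c k else 0 := fun j hj => by
    have := hj.1
    have e : k.succ ≤ i.castSucc ↔ ¬ i ≤ k := by
      simp only [Fin.le_def, Fin.val_succ, Fin.val_castSucc]; omega
    simp only [r, initialIndicator, LinearMap.smul_apply, LinearMap.sub_apply,
      LinearMap.proj_apply, smul_eq_mul, e]
    by_cases h1 : i ≤ k <;> by_cases h2 : j ≤ i.castSucc
    · simp [h1, h2]
    · simp [h1, h2]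
    · simp [h1, h2]
    · exact absurd (this.le.trans (e.2 h1)) h2
  split_ifs with h
  · obtain ⟨q, hq, hN⟩ := h.exists_neighbouring_even hm
    rw [Finset.sum_eq_single q.castSucc]
    · rw [if_pos hN, key _ hN, if_pos ⟨((covers_even hm).1 h).1, by simpa using hq⟩]
    · intro b _ hb
      rw [if_neg fun h' => hb (h'.left_unique hN), LinearMap.zero_apply]
    · simp
  · refine (Finset.sum_eq_zero fun j _ => ?_).trans neg_zero.symm
    split_ifs with hN
    · rw [key _ hN, if_neg fun h' => h (hN.covers_even hm h'.1 h'.2)]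
    · rfl

/-- The coefficients of the sum of the first `M` rows. -/
noncomputable def partialCoeff (T : CompleteTableau n) (c : Fin n → ℚ) (i : Fin n) (M : ℕ) : ℚ :=
  ∑ m ∈ Finset.Icc 1 M, T.rowFunction c m (initialIndicator i)

theorem partialCoeff_zero : T.partialCoeff c i 0 = 0 := by simp [partialCoeff]

theorem partialCoeff_odd (M : ℕ) (h : Odd (M + 1)) :
    T.partialCoeff c i (M + 1) = T.partialCoeff c i M + T.entry c (M + 1) i := by
  rw [partialCoeff, Finset.sum_Icc_succ_top (by omega), rowFunction_odd h]; rfl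

theorem partialCoeff_even (M : ℕ) (h : Even (M + 1)) :
    T.partialCoeff c i (M + 1) = T.partialCoeff c i M - T.entry c (M + 1) i := by
  rw [partialCoeff, Finset.sum_Icc_succ_top (by omega), rowFunction_even h, sub_eq_add_neg]; rfl

theorem f_eq_ofCoeffs (T : CompleteTableau n) (c : Fin n → ℚ) :
    T.f c = ofCoeffs (fun i => T.partialCoeff c i T.totalHeight) := by
  rw [eq_ofCoeffs (T.f c) (by simp [f, LinearMap.sum_apply, rowFunction_const])]
  simp [f, partialCoeff, LinearMap.sum_apply]

/-! ### Comparing the gaps of consecutive elements -/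

section Consecutive

variable {S : Set (Fin n)} {t t' : Fin n}

/-- The index covering gap `t'` lies in `S` and beyond `t`, so consecutiveness makes it `t'` itself.
-/
theorem le_height_right (hS : ∀ a b, T.P a b → b ∈ S → a ∈ S) (h : Consecutive S t t')
    (hm : Odd m) {p : Fin n} (hp : t < p) (hp' : p ≤ t') (hh : m ≤ T.height p.castSucc) :
    m ≤ T.height t'.castSucc := by
  obtain ⟨x, hx, hpx⟩ := exists_covers_odd hm hp' hh
  have hx' := (covers_odd hm).1 hx
  rcases hx'.1.eq_or_lt with rfl | hlt
  · exact hx'.2.1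
  · exact absurd ⟨hp.trans_le hpx, hlt⟩ (h.2.2.2 x (hS _ _ hx.P h.2.1))

theorem le_height_left (hS : ∀ a b, T.P a b → b ∈ S → a ∈ S) (h : Consecutive S t t')
    (hm : Even m) {p : Fin n} (hp : t ≤ p) (hp' : p < t') (hh : m ≤ T.height p.succ) :
    m ≤ T.height t.succ := by
  obtain ⟨x, hx, hpx⟩ := exists_covers_even hm hp hh
  have hx' := (covers_even hm).1 hx
  rcases hx'.1.eq_or_lt with rfl | hlt
  · exact hx'.2.1
  · exact absurd ⟨hlt, hpx.trans_lt hp'⟩ (h.2.2.2 x (hS _ _ hx.P h.1))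

theorem covers_iff_of_consecutive_odd (hS : ∀ a b, T.P a b → b ∈ S → a ∈ S)
    (h : Consecutive S t t') (hm : Odd m) (hh : T.height t'.castSucc < m) (x : Fin n) :
    T.Covers m x t ↔ T.Covers m x t' := by
  constructor <;> intro hx
  · rw [covers_odd hm] at hx ⊢
    refine ⟨hx.1.trans h.2.2.1.le, hx.2.1, fun p hp hpt => ?_⟩
    rcases le_or_gt p t with l | l
    · exact hx.2.2 p hp l
    · by_contra hc
      exact absurd (le_height_right hS h hm l hpt (not_lt.1 hc)) (not_le.2 hh)
  · have hxS := hS _ _ hx.P h.2.1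
    rw [covers_odd hm] at hx ⊢
    have hne : x ≠ t' := by rintro rfl; exact absurd hx.2.1 (not_le.2 hh)
    refine ⟨?_, hx.2.1, fun p hp hpt => hx.2.2 p hp (hpt.trans h.2.2.1.le)⟩
    by_contra hc
    exact h.2.2.2 x hxS ⟨not_le.1 hc, lt_of_le_of_ne hx.1 hne⟩

theorem covers_iff_of_consecutive_even (hS : ∀ a b, T.P a b → b ∈ S → a ∈ S)
    (h : Consecutive S t t') (hm : Even m) (hh : T.height t.succ < m) (x : Fin n) :
    T.Covers m x t ↔ T.Covers m x t' := by
  constructor <;> intro hx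
  · have hxS := hS _ _ hx.P h.1
    rw [covers_even hm] at hx ⊢
    have hne : t ≠ x := by rintro rfl; exact absurd hx.2.1 (not_le.2 hh)
    refine ⟨?_, hx.2.1, fun p hp hpt => hx.2.2 p (h.2.2.1.le.trans hp) hpt⟩
    by_contra hc
    exact h.2.2.2 x hxS ⟨lt_of_le_of_ne hx.1 hne, not_le.1 hc⟩
  · rw [covers_even hm] at hx ⊢
    refine ⟨h.2.2.1.le.trans hx.1, hx.2.1, fun p hp hpt => ?_⟩
    rcases le_or_gt t' p with l | l
    · exact hx.2.2 p l hpt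
    · by_contra hc
      exact absurd (le_height_left hS h hm hp l (not_lt.1 hc)) (not_le.2 hh)

theorem partialCoeff_compare (hc : ∀ k, 0 ≤ c k) (hmono : ∀ a b, T.P a b → c a ≤ c b)
    (hS : ∀ a b, T.P a b → b ∈ S → a ∈ S) (h : Consecutive S t t') (M : ℕ) :
    min 0 (c t' - c t) ≤ T.partialCoeff c t' M - T.partialCoeff c t M := by
  have key := alternating_sum_compare (y := fun m => T.entry c m t) (y' := fun m => T.entry c m t')
    (s := T.partialCoeff c t) (s' := T.partialCoeff c t')
    partialCoeff_zero partialCoeff_zero partialCoeff_odd partialCoeff_even partialCoeff_odd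
    partialCoeff_even (antitone_nat_of_succ_le fun m => entry_succ_le hc hmono m t)
    (antitone_nat_of_succ_le fun m => entry_succ_le hc hmono m t')
    -- Equivalently, `t'` (row odd) or `t` (row even) covers its own gap in row `m`.
    (fun m => (Odd m → m ≤ T.height t'.castSucc) ∧ (Even m → m ≤ T.height t.succ))
    ?_ ?_ ?_ ?_ M
  · simpa only [entry_zero] using key
  · have hlt := Fin.lt_def.1 h.2.2.1
    intro m hq
    constructor <;> intro hm
    · have hh := hq.2 (by simpa [Nat.even_add_one] using hm)
      -- One column is the right end of gap `t` and the left end of gap `t + 1`, which switches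
      -- between the even and odd conventions.
      let p : Fin n := ⟨t + 1, by omega⟩
      have e : p.castSucc = t.succ := Fin.ext rfl
      exact le_height_right hS h hm (p := p) (Fin.lt_def.2 (Nat.lt_succ_self _))
        (Fin.le_def.2 hlt) (by rw [e]; omega)
    · have hh := hq.1 (by simpa [Nat.odd_add_one] using hm)
      let p : Fin n := ⟨t' - 1, by omega⟩
      have e : p.succ = t'.castSucc := Fin.ext (by simp [p]; omega)
      exact le_height_left hS h hm (p := p) (Fin.le_def.2 (by simp [p]; omega))
        (Fin.lt_def.2 (by simp [p]; omega)) (by rw [e]; omega)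
  · intro m hq hm
    have : T.Covers m t' t' :=
      (covers_odd hm).2 ⟨le_rfl, hq.1 hm, fun p h h' => absurd h (not_lt.2 h')⟩
    simp only [entry_zero, this.entry_eq]
  · intro m hq hm
    have : T.Covers m t t :=
      (covers_even hm).2 ⟨le_rfl, hq.2 hm, fun p h h' => absurd h (not_le.2 h')⟩
    simp only [entry_zero, this.entry_eq]
  · intro m hq
    have : ∀ x, T.Covers m x t ↔ T.Covers m x t' := by
      rcases Nat.even_or_odd m with hm | hm
      · exact covers_iff_of_consecutive_even hS h hm
          (by simpa [hm, Nat.not_odd_iff_even.2 hm] using hq)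
      · exact covers_iff_of_consecutive_odd hS h hm
          (by simpa [hm, Nat.not_even_iff_odd.2 hm] using hq)
    by_cases hx : ∃ x, T.Covers m x t
    · obtain ⟨x, hx⟩ := hx
      exact hx.entry_eq.trans ((this x).1 hx).entry_eq.symm
    · exact (entry_eq_zero (not_exists.1 hx)).trans
        (entry_eq_zero fun x h' => not_exists.1 hx x ((this x).2 h')).symm

end Consecutive

end CompleteTableau

end SGraph

theorem proposition3p2 (n : ℕ) (c : Fin n → ℚ) (hc : ∀ k, 0 ≤ c k)
    (prec : Fin n → Fin n → Prop) (hprec : IsStrictTotalOrder (Fin n) prec)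
    (hlift : ∀ i j, prec i j → c i ≤ c j)
    (T : SGraph.CompleteTableau n) (hT : T ∈ SGraph.H prec) :
    ∃ a ∈ SGraph.K c prec, T.f c = SGraph.ofCoeffs a ∧
      ∀ a' : Fin n → ℚ, T.f c = SGraph.ofCoeffs a' → a' = a := by
  have hmono : ∀ a b, T.P a b → c a ≤ c b := fun a b hab => by
    rcases hT a b hab with rfl | h
    · exact le_rfl
    · exact hlift a b h
  refine ⟨fun i => T.partialCoeff c i T.totalHeight, ⟨fun i => ?_, fun k _ t t' h => ?_⟩,
    T.f_eq_ofCoeffs c, fun a' ha' => ?_⟩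
  · have := SGraph.alternating_sum_bounds (y := fun m => T.entry c m i) (s := T.partialCoeff c i)
      SGraph.CompleteTableau.partialCoeff_zero SGraph.CompleteTableau.partialCoeff_odd
      SGraph.CompleteTableau.partialCoeff_even
      (fun m => SGraph.CompleteTableau.entry_nonneg hc m i)
      (fun m => SGraph.CompleteTableau.entry_succ_le hc hmono m i) T.totalHeight
    simpa only [SGraph.CompleteTableau.entry_zero] using this
  · exact SGraph.CompleteTableau.partialCoeff_compare hc hmono
      (fun a b hab hb => SGraph.mem_initialSet_of_prec hprec (hT a b hab) hb) h _
  · rw [T.f_eq_ofCoeffs c] at ha'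
    funext i
    have := congrArg (fun φ => φ (SGraph.initialIndicator i)) ha'
    simpa only [SGraph.ofCoeffs_initialIndicator] using this.symm
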